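/- **Setting.** Let $V:\mathbb R\to\mathbb R$ be even and continuously differentiable, with $\lim_{|t|\to\infty}V(t)/|t|^{1+\varepsilon}=\infty$ for some $\varepsilon>0$. Let $p:\mathbb Z^2\to[0,\infty)$ be finitely supported with $\sum_x p(x)=1$ and $p(-x)=p(x)$. Let $\eta=(\eta_i)_{i\in\mathbb Z^2}$ be i.i.d. real random variables with law $\mathbb P$ of $\eta$ on $\mathbb R^{\mathbb Z^2}$ (expectation $\mathbb E$), where $\eta_0$ and $-\eta_0$ have the same distribution and $0<\mathbb E(\eta_0^2)<\infty$. Write $i\sim j$ if $p(i-j)>0$. The gradient field of $\varphi\in\mathbb R^{\mathbb Z^2}$ is $\varphi'=(\varphi'_{ij})_{i\sim j}$ with $\varphi'_{ij}=\varphi_i-\varphi_j$; let $\Omega'$ be the set of all gradient fields, with the $\sigma$-algebra generated by the coordinates. For a finite $\Lambda\subset\mathbb Z^2$ and $\bar\varphi\in\mathbb R^{\mathbb Z^2}$ let $\mu_\Lambda^{\bar\varphi}[\eta]$ be the probability measure on fields $\varphi$ with $\varphi=\bar\varphi$ off $\Lambda$, under which $(\varphi_i)_{i\in\Lambda}$ has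 Lebesgue density proportional to $$\exp\Big\{-\tfrac12\sum_{i,j\in\Lambda}p(i-j)V(\varphi_i-\varphi_j)-\sum_{i\in\Lambda,\,j\in\Lambda^c}p(i-j)V(\varphi_i-\bar\varphi_j)+\sum_{i\in\Lambda}\eta_i\varphi_i\Big\},$$ and let $(\mu')_\Lambda^{\bar\varphi'}[\eta]$ be the law of $\varphi'$ under $\mu_\Lambda^{\bar\varphi}[\eta]$; it depends on $\bar\varphi$ only through $\bar\varphi'$. (If the above density is not integrable, which occurs only if $p(0)=1$ and $\Lambda\neq\emptyset$, these measures are taken to be zero.) A probability measure $\mu'$ on $\Omega'$ is a *gradient Gibbs measure* for $\eta$ if for all finite $\Lambda$ and all measurable $f:\Omega'\to[0,\infty]$ $$\int\mu'(d\bar\varphi')\int(\mu')_\Lambda^{\bar\varphi'}[\eta](d\varphi')\,f(\varphi')=\int\mu'(d\varphi')\,f(\varphi').$$ With $(\tau_r\eta)_i=\eta_{i-r}$ and $(\tau_r\varphi')_{ij}=\varphi'_{i-r,\,j-r}$, a *translation-covariant random gradient Gibbs measure* is a measurable map $\eta\mapsto\mu'[\eta]$ into measures on $\Omega'$ such that $\mu'[\eta]$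 is a gradient Gibbs measure for $\eta$ for $\mathbb P$-almost every $\eta$, and for every $r\in\mathbb Z^2$, for $\mathbb P$-almost every $\eta$, $\int\mu'[\tau_r\eta](d\varphi')F(\varphi')=\int\mu'[\eta](d\varphi')F(\tau_r\varphi')$ for all measurable $F:\Omega'\to[0,\infty]$. **Theorem 1.1 (Nonexistence in $d=2$).** There is no translation-covariant random gradient Gibbs measure $\mu'$ such that, for all $i\sim j$, the function $\varphi'\mapsto V'(\varphi'_{ij})$ is $\mu'[\eta]$-integrable for $\mathbb P$-almost every $\eta$, and $$\mathbb E\left|\int\mu'[\eta](d\varphi')\,V'(\varphi'_{ij})\right|<\infty .$$ -/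

import Mathlib

open MeasureTheory ProbabilityTheory Filter Topology
open scoped ENNReal

noncomputable section

namespace GradGibbs

/-- Sites of the lattice `ℤ^d`. -/
abbrev Site (d : ℕ) : Type := Fin d → ℤ

/-- Real-valued configurations on the lattice (height fields `φ` as well as disorder
configurations `η`), with the product σ-algebra. -/
abbrev Field (d : ℕ) : Type := Site d → ℝ

/-- `p` is the transition kernel of a symmetric random walk on `ℤ^d` of finite range. -/
structure IsWalkKernel {d : ℕ} (p : Site d → ℝ) : Prop where
  nonneg : ∀ x, 0 ≤ p x
  hasSum_one : HasSum p 1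
  symm : ∀ x, p (-x) = p x
  finite_range : p.support.Finite

/-- `V` is an even, continuously differentiable potential with
`V(t) / |t|^(1+ε) → ∞` as `|t| → ∞`, for some `ε > 0`. -/
structure IsPotential (V : ℝ → ℝ) : Prop where
  even : ∀ t, V (-t) = V t
  contDiff : ContDiff ℝ 1 V
  superlinear : ∃ ε : ℝ, 0 < ε ∧
    Tendsto (fun t : ℝ => V t / |t| ^ (1 + ε)) (cocompact ℝ) atTop

/-- `ν` is a symmetric distribution on the line with finite and nonzero second moment. -/
structure IsDisorderLaw (ν : Measure ℝ) : Prop where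
  isProbabilityMeasure : IsProbabilityMeasure ν
  symm : ν.map (fun x => -x) = ν
  memLp_two : MemLp (fun x : ℝ => x) 2 ν
  second_moment_ne_zero : ∫ x, x ^ 2 ∂ν ≠ 0

/-- The distribution `ℙ` of the disorder `η`: the `η_i` are i.i.d. with law `ν`. -/
def disorderMeasure (d : ℕ) (ν : Measure ℝ) : Measure (Field d) :=
  Measure.infinitePi (fun _ : Site d => ν)

/-- Oriented edges of the graph of the random walk: pairs `(i, j)` with `p (i - j) > 0`. -/
abbrev Edge {d : ℕ} (p : Site d → ℝ) : Type :=
  {e : Site d × Site d // 0 < p (e.1 - e.2)}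

/-- The space of gradient field configurations: the functions on oriented edges of the form
`(i, j) ↦ φ_i - φ_j`, with the σ-algebra generated by the evaluations at edges. -/
abbrev GradField {d : ℕ} (p : Site d → ℝ) : Type :=
  {ψ : Edge p → ℝ // ∃ φ : Field d, ∀ e : Edge p, ψ e = φ e.1.1 - φ e.1.2}

/-- The gradient field of a height field. -/
def grad {d : ℕ} (p : Site d → ℝ) (φ : Field d) : GradField p :=
  ⟨fun e => φ e.1.1 - φ e.1.2, φ, fun _ => rfl⟩

/-- A height field whose gradient field is the given one. The finite-volume gradient Gibbs
measures do not depend on this choice, see `map_grad_finiteGibbs_eq`. -/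
def heights {d : ℕ} {p : Site d → ℝ} (ψ : GradField p) : Field d := ψ.2.choose

theorem grad_heights {d : ℕ} {p : Site d → ℝ} (ψ : GradField p) : grad p (heights ψ) = ψ :=
  Subtype.ext (funext fun e => (ψ.2.choose_spec e).symm)

/-- The shift `(τ_r φ)_i = φ_{i - r}` of configurations on the lattice. -/
def shift {d : ℕ} (r : Site d) (φ : Field d) : Field d := fun i => φ (i - r)

/-- The edge `(i - r, j - r)`. -/
def edgeShift {d : ℕ} {p : Site d → ℝ} (r : Site d) (e : Edge p) : Edge p :=
  ⟨(e.1.1 - r, e.1.2 - r), by simpa using e.2⟩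

/-- The shift `(τ_r φ')_{ij} = φ'_{i - r, j - r}` of gradient fields. -/
def gradShift {d : ℕ} {p : Site d → ℝ} (r : Site d) (ψ : GradField p) : GradField p :=
  ⟨fun e => ψ.1 (edgeShift r e), shift r (heights ψ), fun e => ψ.2.choose_spec (edgeShift r e)⟩

/-- The configuration equal to `x` on `Λ` and to `b` off `Λ`. -/
def glue {d : ℕ} (Λ : Finset (Site d)) (b : Field d) (x : Λ → ℝ) : Field d :=
  fun i => if h : i ∈ Λ then x ⟨i, h⟩ else b i

/-- The energy in the finite volume `Λ` of a configuration `φ`, with the interaction between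
`Λ` and its complement and with the disorder `η` included. The sums over the sites off `Λ` have
finitely many nonzero terms when `p` has finite range. -/
def energy {d : ℕ} (p : Site d → ℝ) (V : ℝ → ℝ) (η : Field d) (Λ : Finset (Site d))
    (φ : Field d) : ℝ :=
  (1 / 2 : ℝ) * ∑ i ∈ Λ, ∑ j ∈ Λ, p (i - j) * V (φ i - φ j)
    + ∑ i ∈ Λ, ∑ᶠ (j : Site d) (_ : j ∉ Λ), p (i - j) * V (φ i - φ j)
    - ∑ i ∈ Λ, η i * φ i

/-- The Boltzmann weight of `x : Λ → ℝ` with boundary condition `b`. -/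
def weight {d : ℕ} (p : Site d → ℝ) (V : ℝ → ℝ) (η : Field d) (Λ : Finset (Site d))
    (b : Field d) (x : Λ → ℝ) : ℝ≥0∞ :=
  ENNReal.ofReal (Real.exp (-energy p V η Λ (glue Λ b x)))

/-- The partition function. -/
def partitionFn {d : ℕ} (p : Site d → ℝ) (V : ℝ → ℝ) (η : Field d) (Λ : Finset (Site d))
    (b : Field d) : ℝ≥0∞ :=
  ∫⁻ x : Λ → ℝ, weight p V η Λ b x

/-- The quenched finite-volume Gibbs measure in `Λ` with boundary condition `b`, as a measure
on all height fields. (It is the zero measure if the partition function is infinite.) -/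
def finiteGibbs {d : ℕ} (p : Site d → ℝ) (V : ℝ → ℝ) (η : Field d) (Λ : Finset (Site d))
    (b : Field d) : Measure (Field d) :=
  (partitionFn p V η Λ b)⁻¹ •
    ((volume : Measure (Λ → ℝ)).withDensity (weight p V η Λ b)).map (glue Λ b)

/-- The finite-volume gradient Gibbs measure in `Λ` with boundary condition `ψ`. -/
def finiteGradGibbs {d : ℕ} (p : Site d → ℝ) (V : ℝ → ℝ) (η : Field d) (Λ : Finset (Site d))
    (ψ : GradField p) : Measure (GradField p) :=
  (finiteGibbs p V η Λ (heights ψ)).map (grad p)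

/-- `μ` is a gradient Gibbs measure for the disorder `η`: a probability measure on gradient
fields that satisfies the DLR equation in every finite volume. -/
structure IsGradientGibbs {d : ℕ} (p : Site d → ℝ) (V : ℝ → ℝ) (η : Field d)
    (μ : Measure (GradField p)) : Prop where
  isProbabilityMeasure : IsProbabilityMeasure μ
  dlr : ∀ (Λ : Finset (Site d)) (f : GradField p → ℝ≥0∞), Measurable f →
    ∫⁻ ψ, ∫⁻ ψ', f ψ' ∂(finiteGradGibbs p V η Λ ψ) ∂μ = ∫⁻ ψ', f ψ' ∂μ

/-- `μ` (a measurable map `η ↦ μ[η]`) is a translation-covariant random gradient Gibbs measure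
for the disorder distribution `P`. -/
structure IsCovariantGradientGibbs {d : ℕ} (p : Site d → ℝ) (V : ℝ → ℝ)
    (P : Measure (Field d)) (μ : Kernel (Field d) (GradField p)) : Prop where
  gibbs : ∀ᵐ η ∂P, IsGradientGibbs p V η (μ η)
  covariant : ∀ r : Site d, ∀ᵐ η ∂P, ∀ f : GradField p → ℝ≥0∞, Measurable f →
    ∫⁻ ψ, f ψ ∂(μ (shift r η)) = ∫⁻ ψ, f (gradShift r ψ) ∂(μ η)

/-- The integrability condition `𝔼 |∫ μ[η](dφ') V'(φ'_{ij})| < ∞` for all edges `ij`: the inner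
integrals exist for almost every `η`, and they are integrable in `η`. -/
def HasIntegrableForce {d : ℕ} (p : Site d → ℝ) (V : ℝ → ℝ)
    (P : Measure (Field d)) (μ : Kernel (Field d) (GradField p)) : Prop :=
  ∀ e : Edge p,
    (∀ᵐ η ∂P, Integrable (fun ψ : GradField p => deriv V (ψ.1 e)) (μ η)) ∧
    Integrable (fun η => ∫ ψ, deriv V (ψ.1 e) ∂(μ η)) P

/-! Well-definedness of the finite-volume gradient Gibbs measures. -/

theorem measurable_glue {d : ℕ} (Λ : Finset (Site d)) (b : Field d) : Measurable (glue Λ b) := by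
  refine measurable_pi_lambda _ fun i => ?_
  by_cases h : i ∈ Λ
  · simpa [glue, h] using measurable_pi_apply _
  · simp [glue, h]

theorem measurable_grad {d : ℕ} (p : Site d → ℝ) : Measurable (grad p) := by
  unfold grad
  fun_prop

theorem grad_shift {d : ℕ} (p : Site d → ℝ) (r : Site d) (φ : Field d) :
    grad p (shift r φ) = gradShift r (grad p φ) := rfl

theorem energy_add {d : ℕ} {p : Site d → ℝ} (hp : ∀ x, 0 ≤ p x) (V : ℝ → ℝ) (η : Field d)
    (Λ : Finset (Site d)) (φ c : Field d) (hc : ∀ i j, 0 < p (i - j) → c i = c j) :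
    energy p V η Λ (φ + c) = energy p V η Λ φ - ∑ i ∈ Λ, η i * c i := by
  have key : ∀ i j, p (i - j) * V ((φ + c) i - (φ + c) j) = p (i - j) * V (φ i - φ j) := by
    intro i j
    rcases (hp (i - j)).eq_or_lt with h | h
    · simp [← h]
    · simp [hc i j h]
  unfold energy
  simp only [key]
  simp only [Pi.add_apply, mul_add, Finset.sum_add_distrib]
  ring

/-- Two height fields with the same gradient field induce the same finite-volume gradient Gibbs
measure. -/
theorem map_grad_finiteGibbs_eq {d : ℕ} {p : Site d → ℝ} (hp : ∀ x, 0 ≤ p x) (V : ℝ → ℝ)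
    (η : Field d) (Λ : Finset (Site d)) (b b' : Field d) (hb : grad p b = grad p b') :
    (finiteGibbs p V η Λ b).map (grad p) = (finiteGibbs p V η Λ b').map (grad p) := by
  set c : Field d := b' - b with hcdef
  have hc : ∀ i j, 0 < p (i - j) → c i = c j := by
    intro i j h
    have h1 := congrFun (congrArg Subtype.val hb) ⟨(i, j), h⟩
    simp only [grad] at h1
    simp only [hcdef, Pi.sub_apply]
    linarith
  set v : Λ → ℝ := fun i => c i.1 with hv
  have hglue : ∀ x, glue Λ b' (x + v) = glue Λ b x + c := by
    intro x
    funext i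
    by_cases h : i ∈ Λ <;> simp [glue, h, hv, hcdef]
  have hgrad : ∀ x, grad p (glue Λ b' (x + v)) = grad p (glue Λ b x) := by
    intro x
    refine Subtype.ext (funext fun e => ?_)
    have := hc _ _ e.2
    simp only [hglue, grad, Pi.add_apply]
    linarith
  set K : ℝ≥0∞ := ENNReal.ofReal (Real.exp (∑ i ∈ Λ, η i * c i)) with hK
  have hK0 : K ≠ 0 := by simp [hK, Real.exp_pos]
  have hKt : K ≠ ∞ := ENNReal.ofReal_ne_top
  have hw : ∀ x, weight p V η Λ b' (x + v) = K * weight p V η Λ b x := by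
    intro x
    rw [weight, weight, hglue, energy_add hp V η Λ _ c hc, hK,
      ← ENNReal.ofReal_mul (Real.exp_pos _).le, ← Real.exp_add]
    congr 2
    ring
  have hZ : partitionFn p V η Λ b' = K * partitionFn p V η Λ b := by
    unfold partitionFn
    rw [← lintegral_add_right_eq_self _ v]
    simp only [hw]
    exact lintegral_const_mul' _ _ hKt
  ext A hA
  have expand : ∀ b, (finiteGibbs p V η Λ b).map (grad p) A = (partitionFn p V η Λ b)⁻¹ *
      ∫⁻ x, ((fun x => grad p (glue Λ b x)) ⁻¹' A).indicator (weight p V η Λ b) x := by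
    intro b
    rw [finiteGibbs, Measure.map_apply (measurable_grad p) hA, Measure.smul_apply, smul_eq_mul,
      Measure.map_apply (measurable_glue Λ b) (measurable_grad p hA),
      withDensity_apply _ (measurable_glue Λ b (measurable_grad p hA)),
      ← lintegral_indicator (measurable_glue Λ b (measurable_grad p hA))]
    rfl
  rw [expand, expand, hZ, ← lintegral_add_right_eq_self
    (((fun x => grad p (glue Λ b' x)) ⁻¹' A).indicator (weight p V η Λ b')) v]
  have hind : ∀ x, ((fun x => grad p (glue Λ b' x)) ⁻¹' A).indicator (weight p V η Λ b') (x + v) =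
      K * ((fun x => grad p (glue Λ b x)) ⁻¹' A).indicator (weight p V η Λ b) x := by
    intro x
    by_cases h : grad p (glue Λ b x) ∈ A
    · rw [Set.indicator_of_mem, Set.indicator_of_mem, hw]
      · exact h
      · simpa [hgrad] using h
    · rw [Set.indicator_of_notMem, Set.indicator_of_notMem, mul_zero]
      · exact h
      · simpa [hgrad] using h
  simp only [hind]
  rw [lintegral_const_mul' _ _ hKt, ENNReal.mul_inv (Or.inl hK0) (Or.inl hKt)]
  rw [show ∀ a b c : ℝ≥0∞, a * b * (K * c) = (K * a) * (b * c) by intros; ring,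
    ENNReal.mul_inv_cancel hK0 hKt, one_mul]

end GradGibbs

end

/-!
At every site, integration by parts under the single-site Gibbs measure shows that `η i` is the
sum of the expected forces `∫ V'(φ'_{ij}) dμ[η]` along the edges at `i`. As `V'` is odd and `μ` is
covariant, this makes `η 0` a finite sum of coboundaries `Z - Z ∘ τ_x` with `Z` integrable. Summed
over a box, such a coboundary telescopes to a boundary sum. In dimension two the boundary of a box
`A` has order `√|A|` sites, so by the mean ergodic theorem the boundary sum, centred on its mean,
is `o(√|A|)` in `L¹`, and the mean cancels between opposite faces. Sums over `A` of nontrivial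
i.i.d. variables, however, fluctuate at order `√|A|`.
-/

noncomputable section

namespace GradGibbs

variable {d : ℕ}

/-! ### Stationary fields -/

theorem measurable_shift (r : Site d) : Measurable (shift r) :=
  measurable_pi_lambda _ fun _ => measurable_pi_apply _

theorem shift_shift (r s : Site d) (φ : Field d) : shift r (shift s φ) = shift (r + s) φ := by
  funext i
  simp [shift, sub_sub]

/-- Stationarity: invariance of the law of a random field under the shifts of the lattice. -/
class IsStationary (P : Measure (Field d)) : Prop where
  measurePreserving_shift : ∀ r : Site d, MeasurePreserving (shift r) P P

/-- The centred sum of the translates of `Z` by the sites of `A`. -/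
def centredSum (P : Measure (Field d)) (Z : Field d → ℝ) (A : Finset (Site d))
    (η : Field d) : ℝ :=
  ∑ i ∈ A, (Z (shift (-i) η) - ∫ ω, Z ω ∂P)

/-- The centred sums of `Z` over `A` are `o(|A|)` in `L¹(P)`, uniformly in the shape of `A`. -/
def HasSmallFluctuations (P : Measure (Field d)) (Z : Field d → ℝ) : Prop :=
  ∀ ε : ℝ, 0 < ε → ∃ C : ℝ, ∀ A : Finset (Site d), ∫ η, |centredSum P Z A η| ∂P ≤ ε * A.card + C

theorem centredSum_add {P : Measure (Field d)} {Z Z' : Field d → ℝ} (hZ : Integrable Z P)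
    (hZ' : Integrable Z' P) (A : Finset (Site d)) :
    centredSum P (Z + Z') A = centredSum P Z A + centredSum P Z' A := by
  funext η
  simp only [centredSum, Pi.add_apply, integral_add hZ hZ', ← Finset.sum_add_distrib]
  exact Finset.sum_congr rfl fun i _ => by ring

section Stationary

variable {P : Measure (Field d)} [IsStationary P] {Z Z' : Field d → ℝ}

theorem integrable_comp_shift (hZ : Integrable Z P) (r : Site d) :
    Integrable (fun η => Z (shift r η)) P :=
  (IsStationary.measurePreserving_shift r).integrable_comp_of_integrable hZ

theorem integral_comp_shift (hZ : AEStronglyMeasurable Z P) (r : Site d) :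
    ∫ η, Z (shift r η) ∂P = ∫ η, Z η ∂P := by
  have h := IsStationary.measurePreserving_shift (P := P) r
  rw [← integral_map h.measurable.aemeasurable (by rwa [h.map_eq]), h.map_eq]

variable [IsProbabilityMeasure P]

theorem integrable_centredSum (hZ : Integrable Z P) (A : Finset (Site d)) :
    Integrable (centredSum P Z A) P :=
  integrable_finsetSum _ fun _ _ => (integrable_comp_shift hZ _).sub (integrable_const _)

theorem integral_abs_centredSum_add_le (hZ : Integrable Z P) (hZ' : Integrable Z' P)
    (A : Finset (Site d)) :
    ∫ η, |centredSum P (Z + Z') A η| ∂P ≤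
      ∫ η, |centredSum P Z A η| ∂P + ∫ η, |centredSum P Z' A η| ∂P := by
  have hi := integrable_centredSum hZ A
  have hi' := integrable_centredSum hZ' A
  rw [centredSum_add hZ hZ', ← integral_add hi.abs hi'.abs]
  exact integral_mono (hi.add hi').abs (hi.abs.add hi'.abs) fun η => abs_add_le _ _

theorem integral_abs_centredSum_le (hZ : Integrable Z P) (A : Finset (Site d)) :
    ∫ η, |centredSum P Z A η| ∂P ≤ 2 * A.card * ∫ η, |Z η| ∂P := by
  have hi (i : Site d) : Integrable (fun η => |Z (shift (-i) η)| + ∫ ω, |Z ω| ∂P) P :=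
    (integrable_comp_shift hZ (-i)).abs.add (integrable_const _)
  have htwo (i : Site d) :
      ∫ η, (|Z (shift (-i) η)| + ∫ ω, |Z ω| ∂P) ∂P = 2 * ∫ ω, |Z ω| ∂P := by
    rw [integral_add (integrable_comp_shift hZ (-i)).abs (integrable_const _),
      integral_comp_shift (Z := fun η => |Z η|) hZ.abs.aestronglyMeasurable, integral_const,
      probReal_univ, one_smul, two_mul]
  calc ∫ η, |centredSum P Z A η| ∂P
      ≤ ∫ η, ∑ i ∈ A, (|Z (shift (-i) η)| + ∫ ω, |Z ω| ∂P) ∂P := by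
        refine integral_mono (integrable_centredSum hZ A).abs
          (integrable_finsetSum _ fun i _ => hi i) fun η => ?_
        refine (Finset.abs_sum_le_sum_abs _ _).trans (Finset.sum_le_sum fun i _ => ?_)
        exact (abs_sub _ _).trans (add_le_add le_rfl abs_integral_le_integral_abs)
    _ = 2 * A.card * ∫ η, |Z η| ∂P := by
        rw [integral_finsetSum _ fun i _ => hi i, Finset.sum_congr rfl fun i _ => htwo i,
          Finset.sum_const, nsmul_eq_mul]
        ring

theorem HasSmallFluctuations.add (h : HasSmallFluctuations P Z) (h' : HasSmallFluctuations P Z')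
    (hZ : Integrable Z P) (hZ' : Integrable Z' P) : HasSmallFluctuations P (Z + Z') := by
  intro ε hε
  obtain ⟨C, hC⟩ := h (ε / 2) (half_pos hε)
  obtain ⟨C', hC'⟩ := h' (ε / 2) (half_pos hε)
  refine ⟨C + C', fun A => (integral_abs_centredSum_add_le hZ hZ' A).trans ?_⟩
  linarith [hC A, hC' A]

theorem HasSmallFluctuations.of_approx (hZ : Integrable Z P)
    (h : ∀ δ : ℝ, 0 < δ → ∃ Z' : Field d → ℝ, Integrable Z' P ∧ HasSmallFluctuations P Z' ∧
      ∫ η, |Z η - Z' η| ∂P ≤ δ) :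
    HasSmallFluctuations P Z := by
  intro ε hε
  obtain ⟨Z', hZ', hfluct, hδ⟩ := h (ε / 4) (by positivity)
  obtain ⟨C, hC⟩ := hfluct (ε / 2) (half_pos hε)
  refine ⟨C, fun A => ?_⟩
  have hsplit := integral_abs_centredSum_add_le hZ' (hZ.sub hZ') A
  rw [add_sub_cancel] at hsplit
  have hdiff : ∫ η, |centredSum P (Z - Z') A η| ∂P ≤ 2 * A.card * (ε / 4) :=
    (integral_abs_centredSum_le (hZ.sub hZ') A).trans (by gcongr; exact hδ)
  linarith [hC A]

end Stationary

/-! ### The mean ergodic theorem for i.i.d. fields -/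

instance isProbabilityMeasure_disorderMeasure (ν : Measure ℝ) [IsProbabilityMeasure ν] :
    IsProbabilityMeasure (disorderMeasure d ν) := by
  unfold disorderMeasure
  infer_instance

instance isStationary_disorderMeasure (ν : Measure ℝ) [IsProbabilityMeasure ν] :
    IsStationary (disorderMeasure d ν) :=
  ⟨fun r => ⟨measurable_shift r, Measure.map_infinitePi_infinitePi_of_inj (P := fun _ => ν)
    (f := fun i => i - r) sub_left_injective⟩⟩

theorem iIndepFun_disorderMeasure (ν : Measure ℝ) [IsProbabilityMeasure ν] :
    iIndepFun (fun (i : Site d) (η : Field d) => η i) (disorderMeasure d ν) :=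
  iIndepFun_infinitePi (X := fun _ x => x) fun _ => measurable_id

theorem integral_abs_sub_integral_le_sqrt_variance {Ω : Type*} [MeasurableSpace Ω]
    {P : Measure Ω} [IsProbabilityMeasure P] {Y : Ω → ℝ} (hY : MemLp Y 2 P) :
    ∫ ω, |Y ω - ∫ ω', Y ω' ∂P| ∂P ≤ √(Var[Y; P]) := by
  have hdev : MemLp (fun ω => |Y ω - ∫ ω', Y ω' ∂P|) 2 P := (hY.sub (memLp_const _)).abs
  have hvar := variance_nonneg (fun ω => |Y ω - ∫ ω', Y ω' ∂P|) P
  rw [variance_eq_sub hdev] at hvar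
  refine Real.le_sqrt_of_sq_le ?_
  rw [variance_eq_integral hY.aestronglyMeasurable.aemeasurable]
  simp only [Pi.pow_apply, sq_abs] at hvar
  linarith

theorem covariance_le_half_add_variance {Ω : Type*} [MeasurableSpace Ω] {P : Measure Ω}
    [IsFiniteMeasure P] {X Y : Ω → ℝ} (hX : MemLp X 2 P) (hY : MemLp Y 2 P) :
    cov[X, Y; P] ≤ (Var[X; P] + Var[Y; P]) / 2 := by
  have h := variance_nonneg (X - Y) P
  rw [variance_sub hX hY] at h
  linarith

section Local

variable {ν : Measure ℝ} [IsProbabilityMeasure ν] {K : Finset (Site d)} {f : (K → ℝ) → ℝ}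

theorem indepFun_restrict_shift (hf : Measurable f) {i j : Site d}
    (hij : ∀ k ∈ K, ∀ l ∈ K, k + i ≠ l + j) :
    IndepFun (fun η : Field d => f (K.restrict (shift (-i) η)))
      (fun η => f (K.restrict (shift (-j) η))) (disorderMeasure d ν) := by
  classical
  have hdisj : Disjoint (K.image (· + i)) (K.image (· + j)) := by
    simp only [Finset.disjoint_left, Finset.mem_image]
    rintro _ ⟨k, hk, rfl⟩ ⟨l, hl, h⟩
    exact hij k hk l hl h.symm
  let read (i : Site d) (y : K.image (· + i) → ℝ) : K → ℝ :=
    fun k => y ⟨k + i, Finset.mem_image_of_mem _ k.2⟩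
  have hread (i : Site d) (η : Field d) :
      K.restrict (shift (-i) η) = read i fun a => η a := by
    funext k
    simp [read, shift]
  have hmeas (i : Site d) : Measurable fun y => f (read i y) :=
    hf.comp (measurable_pi_lambda _ fun k => measurable_pi_apply _)
  simp only [hread]
  exact ((iIndepFun_disorderMeasure ν).indepFun_finset _ _ hdisj fun i =>
    measurable_pi_apply i).comp (hmeas i) (hmeas j)

theorem variance_sum_restrict_shift_le (hf : Measurable f)
    (hL2 : MemLp (fun η => f (K.restrict η)) 2 (disorderMeasure d ν)) (A : Finset (Site d)) :
    Var[fun η => ∑ i ∈ A, f (K.restrict (shift (-i) η)); disorderMeasure d ν] ≤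
      A.card * ((K ×ˢ K).card * Var[fun η => f (K.restrict η); disorderMeasure d ν]) := by
  classical
  set P := disorderMeasure d ν
  set Y : Site d → Field d → ℝ := fun i η => f (K.restrict (shift (-i) η))
  set v := Var[fun η => f (K.restrict η); P]
  have hshift (i : Site d) : MeasurePreserving (shift (-i)) P P :=
    IsStationary.measurePreserving_shift (-i)
  have hY (i : Site d) : MemLp (Y i) 2 P := hL2.comp_measurePreserving (hshift i)
  have hvar (i : Site d) : Var[Y i; P] = v :=
    (hshift i).variance_fun_comp hL2.aestronglyMeasurable.aemeasurable
  have hcov (i j : Site d) : cov[Y i, Y j; P] ≤ v := by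
    linarith [covariance_le_half_add_variance (hY i) (hY j), hvar i, hvar j]
  have hcov_zero (i j : Site d) (hj : j ∉ (K ×ˢ K).image fun q => q.1 + i - q.2) :
      cov[Y i, Y j; P] = 0 := by
    refine (indepFun_restrict_shift hf fun k hk l hl h => hj ?_).covariance_eq_zero (hY i) (hY j)
    exact Finset.mem_image.2 ⟨(k, l), Finset.mk_mem_product hk hl, by simp [h]⟩
  rw [variance_fun_sum' fun i _ => hY i, ← nsmul_eq_mul]
  refine Finset.sum_le_card_nsmul _ _ _ fun i _ => ?_
  set N := (K ×ˢ K).image fun q => q.1 + i - q.2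
  calc ∑ j ∈ A, cov[Y i, Y j; P]
      = ∑ j ∈ A with j ∈ N, cov[Y i, Y j; P] := by
        refine (Finset.sum_filter_of_ne fun j _ h => ?_).symm
        exact not_imp_comm.1 (hcov_zero i j) h
    _ ≤ (A.filter (· ∈ N)).card * v := by
        rw [← nsmul_eq_mul]
        exact Finset.sum_le_card_nsmul _ _ _ fun j _ => hcov i j
    _ ≤ (K ×ˢ K).card * v := by
        gcongr
        · exact variance_nonneg _ _
        · exact (Finset.card_le_card fun j hj => (Finset.mem_filter.1 hj).2).trans
            Finset.card_image_le

theorem hasSmallFluctuations_restrict (hf : Measurable f)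
    (hL2 : MemLp (fun η => f (K.restrict η)) 2 (disorderMeasure d ν)) :
    HasSmallFluctuations (disorderMeasure d ν) fun η => f (K.restrict η) := by
  set P := disorderMeasure d ν
  set M := (K ×ˢ K).card * Var[fun η => f (K.restrict η); P]
  have hM : 0 ≤ M := mul_nonneg (Nat.cast_nonneg _) (variance_nonneg _ _)
  have hY (i : Site d) : MemLp (fun η => f (K.restrict (shift (-i) η))) 2 P :=
    hL2.comp_measurePreserving (IsStationary.measurePreserving_shift (-i))
  have hcentred (A : Finset (Site d)) (η : Field d) :
      centredSum P (fun η => f (K.restrict η)) A η =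
        (∑ i ∈ A, f (K.restrict (shift (-i) η))) -
          ∫ ω, ∑ i ∈ A, f (K.restrict (shift (-i) ω)) ∂P := by
    rw [integral_finsetSum _ fun i _ => (hY i).integrable one_le_two, ← Finset.sum_sub_distrib]
    exact Finset.sum_congr rfl fun i _ => by
      rw [integral_comp_shift (Z := fun η => f (K.restrict η)) hL2.aestronglyMeasurable]
  intro ε hε
  refine ⟨M / (4 * ε), fun A => ?_⟩
  calc ∫ η, |centredSum P (fun η => f (K.restrict η)) A η| ∂P
      ≤ √(Var[fun η => ∑ i ∈ A, f (K.restrict (shift (-i) η)); P]) := by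
        simp only [hcentred]
        exact integral_abs_sub_integral_le_sqrt_variance (memLp_finsetSum _ fun i _ => hY i)
    _ ≤ √(A.card * M) := Real.sqrt_le_sqrt (variance_sum_restrict_shift_le hf hL2 A)
    _ ≤ ε * A.card + M / (4 * ε) := by
        refine Real.sqrt_le_iff.2 ⟨by positivity, ?_⟩
        have hmul : ε * A.card * (M / (4 * ε)) * 4 = A.card * M := by field_simp
        nlinarith [sq_nonneg (ε * A.card - M / (4 * ε))]

end Local

theorem measureDense_measurableCylinders (P : Measure (Field d)) [IsFiniteMeasure P] :
    P.MeasureDense (measurableCylinders fun _ : Site d => ℝ) :=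
  Measure.MeasureDense.of_generateFrom_isSetAlgebra_finite P
    ⟨empty_mem_measurableCylinders _, fun _ h => compl_mem_measurableCylinders h,
      fun _ _ h h' => union_mem_measurableCylinders h h'⟩
    generateFrom_measurableCylinders.symm

theorem exists_cylinder_eLpNorm_indicator_sub_le (P : Measure (Field d)) [IsFiniteMeasure P]
    {s : Set (Field d)} (hs : MeasurableSet s) (c : ℝ) {ε : ℝ≥0∞} (hε : ε ≠ 0) :
    ∃ (K : Finset (Site d)) (S : Set (K → ℝ)), MeasurableSet S ∧
      eLpNorm ((cylinder K S).indicator (fun _ => c) - s.indicator fun _ => c) 1 P ≤ ε := by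
  obtain ⟨δ, hδ, hsmall⟩ := exists_eLpNorm_indicator_le (μ := P) ENNReal.one_ne_top c hε
  obtain ⟨t, ht, hst⟩ := (measureDense_measurableCylinders P).approx s hs (measure_ne_top _ _)
    δ hδ
  obtain ⟨K, S, hS, rfl⟩ := (mem_measurableCylinders t).1 ht
  refine ⟨K, S, hS, ?_⟩
  rw [eLpNorm_indicator_sub_indicator, symmDiff_comm]
  exact hsmall _ (hst.le.trans_eq (ENNReal.ofReal_coe_nnreal))

theorem hasSmallFluctuations_indicator_cylinder {ν : Measure ℝ} [IsProbabilityMeasure ν]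
    {K : Finset (Site d)} {S : Set (K → ℝ)} (hS : MeasurableSet S) (c : ℝ) :
    HasSmallFluctuations (disorderMeasure d ν) ((cylinder K S).indicator fun _ => c) :=
  hasSmallFluctuations_restrict (f := S.indicator fun _ => c) (measurable_const.indicator hS)
    ((memLp_const c).indicator hS.cylinder)

theorem hasSmallFluctuations_of_integrable {ν : Measure ℝ} [IsProbabilityMeasure ν]
    {Z : Field d → ℝ} (hZ : Integrable Z (disorderMeasure d ν)) :
    HasSmallFluctuations (disorderMeasure d ν) Z := by
  set P := disorderMeasure d ν
  refine .of_approx hZ fun δ hδ => ?_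
  have hindicator (c : ℝ) ⦃s : Set (Field d)⦄ (hs : MeasurableSet s) (_ : P s < ∞) {ε : ℝ≥0∞}
      (hε : ε ≠ 0) : ∃ Z' : Field d → ℝ, eLpNorm (Z' - s.indicator fun _ => c) 1 P ≤ ε ∧
        Integrable Z' P ∧ HasSmallFluctuations P Z' := by
    obtain ⟨K, S, hS, hdist⟩ := exists_cylinder_eLpNorm_indicator_sub_le P hs c hε
    exact ⟨_, hdist, (integrable_const c).indicator hS.cylinder,
      hasSmallFluctuations_indicator_cylinder hS c⟩
  obtain ⟨Z', hdist, hZ', hfluct⟩ := (memLp_one_iff_integrable.2 hZ).induction_dense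
    ENNReal.one_ne_top _ hindicator
    (fun f g hf hg => ⟨hf.1.add hg.1, hf.2.add hg.2 hf.1 hg.1⟩)
    (fun f hf => hf.1.aestronglyMeasurable) (ENNReal.ofReal_pos.2 hδ).ne'
  have hnorm := integral_norm_eq_lintegral_enorm (hZ.sub hZ').aestronglyMeasurable
  rw [← eLpNorm_one_eq_lintegral_enorm] at hnorm
  exact ⟨Z', hZ', hfluct, hnorm.trans_le (ENNReal.toReal_le_of_le_ofReal hδ.le hdist)⟩

/-! ### Coboundaries over boxes -/

/-- The box `[0, L)^d`. -/
def box (d L : ℕ) : Finset (Site d) := Fintype.piFinset fun _ => Finset.Ico (0 : ℤ) L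

theorem card_box (d L : ℕ) : (box d L).card = L ^ d := by
  simp [box]

theorem card_Ico_sdiff_Ico_add_le (L : ℕ) (y : ℤ) :
    (Finset.Ico (0 : ℤ) L \ Finset.Ico y (L + y)).card ≤ y.natAbs := by
  have hsub : Finset.Ico (0 : ℤ) L \ Finset.Ico y (L + y) ⊆
      Finset.Ico 0 y ∪ Finset.Ico (L + y) L := fun a ha => by
    simp only [Finset.mem_sdiff, Finset.mem_union, Finset.mem_Ico] at ha ⊢
    omega
  refine (Finset.card_le_card hsub).trans ((Finset.card_union_le _ _).trans ?_)
  simp only [Int.card_Ico]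
  omega

theorem card_box_sdiff_map_le (L : ℕ) (x : Site d) :
    (box d L \ (box d L).map (addRightEmbedding x)).card ≤
      (∑ k, (x k).natAbs) * L ^ (d - 1) := by
  let side : Finset ℤ := Finset.Ico 0 L
  let slab (k : Fin d) : Finset (Site d) :=
    Fintype.piFinset (Function.update (fun _ => side) k (side \ Finset.Ico (x k) (L + x k)))
  have hsub : box d L \ (box d L).map (addRightEmbedding x) ⊆ Finset.univ.biUnion slab := by
    intro i hi
    obtain ⟨hbox, hmap⟩ := Finset.mem_sdiff.1 hi
    have hshifted : i - x ∉ box d L := fun h =>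
      hmap (Finset.mem_map.2 ⟨i - x, h, sub_add_cancel i x⟩)
    simp only [box, Fintype.mem_piFinset] at hbox hshifted
    obtain ⟨k, hk⟩ := not_forall.1 hshifted
    simp only [Finset.mem_biUnion, Finset.mem_univ, true_and, slab, Fintype.mem_piFinset]
    refine ⟨k, fun j => ?_⟩
    rcases eq_or_ne j k with rfl | hj
    · have hbox := hbox j
      simp only [Function.update_self, side, Finset.mem_sdiff, Finset.mem_Ico, Pi.sub_apply]
        at hbox hk ⊢
      omega
    · simpa [hj, side] using hbox j
  have hslab (k : Fin d) : (slab k).card ≤ (x k).natAbs * L ^ (d - 1) := by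
    have hprod := Finset.prod_update_of_mem (Finset.mem_univ k) (fun _ => side.card)
      (side \ Finset.Ico (x k) (L + x k)).card
    rw [Fintype.card_piFinset]
    simp only [Function.apply_update fun _ => Finset.card]
    rw [hprod, Finset.prod_const, Finset.card_sdiff_of_subset (Finset.subset_univ _)]
    simpa [side] using Nat.mul_le_mul_right _ (card_Ico_sdiff_Ico_add_le L (x k))
  refine (Finset.card_le_card hsub).trans (Finset.card_biUnion_le.trans ?_)
  rw [Finset.sum_mul]
  exact Finset.sum_le_sum fun k _ => hslab k

theorem sum_sub_sum_translate (A : Finset (Site d)) (x : Site d) (u : Site d → ℝ) :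
    ∑ i ∈ A, (u i - u (i + x)) =
      ∑ i ∈ A \ A.map (addRightEmbedding x), u i - ∑ i ∈ A.map (addRightEmbedding x) \ A, u i := by
  rw [Finset.sum_sdiff_sub_sum_sdiff, Finset.sum_sub_distrib, Finset.sum_map]
  rfl

section Coboundary

variable {ν : Measure ℝ} [IsProbabilityMeasure ν] {Z : Field d → ℝ}

theorem exists_integral_abs_sum_coboundary_le (hZ : Integrable Z (disorderMeasure d ν))
    (x : Site d) {ε : ℝ} (hε : 0 < ε) :
    ∃ C : ℝ, ∀ A : Finset (Site d),
      ∫ η, |∑ i ∈ A, (Z (shift (-i) η) - Z (shift (-(i + x)) η))| ∂(disorderMeasure d ν) ≤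
        ε * (A \ A.map (addRightEmbedding x)).card + C := by
  set P := disorderMeasure d ν
  obtain ⟨C, hC⟩ := hasSmallFluctuations_of_integrable hZ (ε / 2) (half_pos hε)
  refine ⟨2 * C, fun A => ?_⟩
  set B := A.map (addRightEmbedding x)
  have hcentred (η : Field d) : ∑ i ∈ A, (Z (shift (-i) η) - Z (shift (-(i + x)) η)) =
      centredSum P Z (A \ B) η - centredSum P Z (B \ A) η := by
    simpa only [sub_sub_sub_cancel_right, centredSum] using
      sum_sub_sum_translate A x fun i => Z (shift (-i) η) - ∫ ω, Z ω ∂P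
  have hi := integrable_centredSum hZ (A \ B)
  have hi' := integrable_centredSum hZ (B \ A)
  calc ∫ η, |∑ i ∈ A, (Z (shift (-i) η) - Z (shift (-(i + x)) η))| ∂P
      ≤ ∫ η, |centredSum P Z (A \ B) η| ∂P + ∫ η, |centredSum P Z (B \ A) η| ∂P := by
        simp only [hcentred]
        rw [← integral_add hi.abs hi'.abs]
        exact integral_mono (hi.sub hi').abs (hi.abs.add hi'.abs) fun η => abs_sub _ _
    _ ≤ ε / 2 * (A \ B).card + C + (ε / 2 * (B \ A).card + C) := add_le_add (hC _) (hC _)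
    _ = ε * (A \ B).card + 2 * C := by
        rw [Finset.card_sdiff_comm (s := B) (t := A) (Finset.card_map _)]
        ring

theorem tendsto_integral_abs_sum_coboundary (hZ : Integrable Z (disorderMeasure d ν))
    (x : Site d) {A : ℕ → Finset (Site d)} {k : ℝ}
    (hbdry : ∀ᶠ n in atTop, ((A n \ (A n).map (addRightEmbedding x)).card : ℝ) ≤
      k * √((A n).card : ℝ))
    (hcard : Tendsto (fun n => (A n).card) atTop atTop) :
    Tendsto (fun n => (∫ η, |∑ i ∈ A n, (Z (shift (-i) η) - Z (shift (-(i + x)) η))|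
      ∂(disorderMeasure d ν)) / √((A n).card : ℝ)) atTop (𝓝 0) := by
  set P := disorderMeasure d ν
  have hsqrt : Tendsto (fun n => √((A n).card : ℝ)) atTop atTop :=
    Real.tendsto_sqrt_atTop.comp (tendsto_natCast_atTop_atTop.comp hcard)
  rw [Metric.tendsto_nhds]
  intro δ hδ
  obtain ⟨C, hC⟩ := exists_integral_abs_sum_coboundary_le hZ x
    (ε := δ / (2 * (|k| + 1))) (by positivity)
  filter_upwards [hbdry, hsqrt.eventually_gt_atTop 0, hsqrt.eventually_gt_atTop (2 * C / δ)]
    with n hn hpos hlarge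
  rw [Real.dist_0_eq_abs, abs_of_nonneg (by positivity), div_lt_iff₀ hpos]
  have hk : δ / (2 * (|k| + 1)) * (k * √((A n).card : ℝ)) ≤ δ / 2 * √((A n).card : ℝ) := by
    have hratio : k / (|k| + 1) ≤ 1 :=
      (div_le_one (by positivity)).2 ((le_abs_self k).trans (by linarith))
    calc δ / (2 * (|k| + 1)) * (k * √((A n).card : ℝ))
        = δ / 2 * √((A n).card : ℝ) * (k / (|k| + 1)) := by field_simp
      _ ≤ δ / 2 * √((A n).card : ℝ) := mul_le_of_le_one_right (by positivity) hratio
  have hC' : C < δ / 2 * √((A n).card : ℝ) := by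
    rw [div_lt_iff₀ hδ] at hlarge
    linarith
  have hmono : δ / (2 * (|k| + 1)) * ((A n \ (A n).map (addRightEmbedding x)).card : ℝ) ≤
      δ / (2 * (|k| + 1)) * (k * √((A n).card : ℝ)) := by gcongr
  linarith [hC (A n)]

theorem tendsto_integral_abs_sum_coboundary_box (hd₀ : d ≠ 0) (hd : d ≤ 2)
    (hZ : Integrable Z (disorderMeasure d ν)) (x : Site d) :
    Tendsto (fun L => (∫ η, |∑ i ∈ box d L, (Z (shift (-i) η) - Z (shift (-(i + x)) η))|
      ∂(disorderMeasure d ν)) / √((box d L).card : ℝ)) atTop (𝓝 0) := by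
  refine tendsto_integral_abs_sum_coboundary hZ x (k := (∑ k, (x k).natAbs : ℕ)) ?_ ?_
  · filter_upwards [eventually_ge_atTop 1] with L hL
    have hpow : (L : ℝ) ^ (d - 1) ≤ √((L ^ d : ℕ) : ℝ) := by
      refine Real.le_sqrt_of_sq_le ?_
      rw [← pow_mul, Nat.cast_pow]
      exact pow_le_pow_right₀ (by exact_mod_cast hL) (by omega)
    calc ((box d L \ (box d L).map (addRightEmbedding x)).card : ℝ)
        ≤ (∑ k, (x k).natAbs : ℕ) * (L : ℝ) ^ (d - 1) := by
          exact_mod_cast card_box_sdiff_map_le L x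
      _ ≤ (∑ k, (x k).natAbs : ℕ) * √((box d L).card : ℝ) := by
          rw [card_box]
          gcongr
  · simp only [card_box]
    exact tendsto_pow_atTop hd₀

end Coboundary

/-! ### Sums of i.i.d. variables -/

section SumIID

theorem norm_charFun_map_sub_one_le {Ω : Type*} [MeasurableSpace Ω] {P : Measure Ω}
    [IsProbabilityMeasure P] {Y : Ω → ℝ} (hY : Integrable Y P) (t : ℝ) :
    ‖charFun (P.map Y) t - 1‖ ≤ |t| * ∫ ω, |Y ω| ∂P := by
  have hm := hY.aestronglyMeasurable.aemeasurable
  have hexp : Integrable (fun ω => Complex.exp (t * Y ω * Complex.I)) P := by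
    refine Integrable.of_bound (by fun_prop) 1 (ae_of_all _ fun ω => ?_)
    rw [← Complex.ofReal_mul, Complex.norm_exp_ofReal_mul_I]
  have hsub : charFun (P.map Y) t - 1 = ∫ ω, (Complex.exp (t * Y ω * Complex.I) - 1) ∂P := by
    rw [charFun_apply_real, integral_map hm (by fun_prop), integral_sub hexp (integrable_const _)]
    simp
  rw [hsub, ← integral_const_mul]
  refine norm_integral_le_of_norm_le (hY.abs.const_mul _) (ae_of_all _ fun ω => ?_)
  have := Real.norm_exp_I_mul_ofReal_sub_one_le (x := t * Y ω)
  rwa [Real.norm_eq_abs, abs_mul, mul_comm Complex.I, Complex.ofReal_mul] at this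

theorem norm_charFun_sq_eq_integral_cos (ν : Measure ℝ) [IsProbabilityMeasure ν] (t : ℝ) :
    ‖charFun ν t‖ ^ 2 = ∫ z, Real.cos (t * (z.1 - z.2)) ∂(ν.prod ν) := by
  have hexp : Integrable (fun z : ℝ × ℝ => Complex.exp ((t * (z.1 - z.2) : ℝ) * Complex.I))
      (ν.prod ν) :=
    Integrable.of_bound (by fun_prop) 1 (ae_of_all _ fun z => by
      rw [Complex.norm_exp_ofReal_mul_I])
  have hprod : ((‖charFun ν t‖ ^ 2 : ℝ) : ℂ) =
      ∫ z, Complex.exp ((t * (z.1 - z.2) : ℝ) * Complex.I) ∂(ν.prod ν) := by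
    rw [Complex.ofReal_pow, ← Complex.mul_conj', ← charFun_neg, charFun_apply_real,
      charFun_apply_real, ← integral_prod_mul]
    congr 1 with z
    rw [← Complex.exp_add]
    congr 1
    push_cast
    ring
  calc ‖charFun ν t‖ ^ 2
      = (∫ z, Complex.exp ((t * (z.1 - z.2) : ℝ) * Complex.I) ∂(ν.prod ν)).re := by
        rw [← hprod, Complex.ofReal_re]
    _ = ∫ z, (Complex.exp ((t * (z.1 - z.2) : ℝ) * Complex.I)).re ∂(ν.prod ν) :=
        (integral_re hexp).symm
    _ = ∫ z, Real.cos (t * (z.1 - z.2)) ∂(ν.prod ν) := by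
        simp only [Complex.exp_ofReal_mul_I_re]

theorem tendsto_mul_one_sub_of_tendsto_pow {r : ℕ → ℝ} {N : ℕ → ℕ} (h0 : ∀ n, 0 ≤ r n)
    (h1 : ∀ n, r n ≤ 1) (h : Tendsto (fun n => r n ^ N n) atTop (𝓝 1)) :
    Tendsto (fun n => N n * (1 - r n)) atTop (𝓝 0) := by
  have hlog : Tendsto (fun n => -Real.log (r n ^ N n)) atTop (𝓝 0) := by
    simpa using (h.log one_ne_zero).neg
  refine squeeze_zero' (Eventually.of_forall fun n => ?_) ?_ hlog
  · exact mul_nonneg (Nat.cast_nonneg _) (sub_nonneg.2 (h1 n))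
  · filter_upwards [h.eventually_ne one_ne_zero] with n hn
    rcases (h0 n).eq_or_lt with hr | hr
    · have hN : N n = 0 := by
        by_contra hN
        exact hn (by rw [← hr, zero_pow hN])
      simp [hN]
    · rw [Real.log_pow, ← mul_neg]
      gcongr
      linarith [Real.log_le_sub_one_of_pos hr]

theorem ae_eq_zero_of_tendsto_integral_one_sub_cos {Ω : Type*} [MeasurableSpace Ω]
    {P : Measure Ω} [IsFiniteMeasure P] {U : Ω → ℝ} (hU : Measurable U) {t : ℕ → ℝ}
    (ht0 : ∀ᶠ n in atTop, t n ≠ 0) (ht : Tendsto t atTop (𝓝 0))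
    (h : Tendsto (fun n => (∫ ω, (1 - Real.cos (t n * U ω)) ∂P) / t n ^ 2) atTop (𝓝 0)) :
    U =ᵐ[P] 0 := by
  set F : ℕ → Ω → ℝ≥0∞ := fun n ω => ENNReal.ofReal ((1 - Real.cos (t n * U ω)) / t n ^ 2)
  have hFm (n : ℕ) : Measurable (F n) := by fun_prop
  have hF : Tendsto (fun n => ∫⁻ ω, F n ω ∂P) atTop (𝓝 0) := by
    rw [← ENNReal.ofReal_zero]
    refine (ENNReal.tendsto_ofReal h).congr fun n => ?_
    rw [← integral_div]
    refine ofReal_integral_eq_lintegral_ofReal ?_ (ae_of_all _ fun ω => ?_)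
    · refine (Integrable.of_bound (by fun_prop) 2 (ae_of_all _ fun ω => ?_)).div_const _
      rw [Real.norm_eq_abs, abs_le]
      constructor <;> linarith [Real.neg_one_le_cos (t n * U ω), Real.cos_le_one (t n * U ω)]
    · exact div_nonneg (sub_nonneg.2 (Real.cos_le_one _)) (sq_nonneg _)
  have hlower (ω : Ω) : ENNReal.ofReal (2 / Real.pi ^ 2 * U ω ^ 2) ≤
      liminf (fun n => F n ω) atTop := by
    have htU : Tendsto (fun n => |t n * U ω|) atTop (𝓝 0) := by
      simpa using (ht.mul_const (U ω)).abs
    refine le_liminf_of_le (by isBoundedDefault) ?_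
    filter_upwards [ht0, htU.eventually_le_const Real.pi_pos] with n hn hsmall
    refine ENNReal.ofReal_le_ofReal ((le_div_iff₀ (by positivity)).2 ?_)
    linarith [Real.cos_le_one_sub_mul_cos_sq hsmall]
  have hzero : ∫⁻ ω, ENNReal.ofReal (2 / Real.pi ^ 2 * U ω ^ 2) ∂P = 0 := by
    refine le_antisymm ?_ zero_le
    calc ∫⁻ ω, ENNReal.ofReal (2 / Real.pi ^ 2 * U ω ^ 2) ∂P
        ≤ ∫⁻ ω, liminf (fun n => F n ω) atTop ∂P := lintegral_mono hlower
      _ ≤ liminf (fun n => ∫⁻ ω, F n ω ∂P) atTop := lintegral_liminf_le hFm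
      _ = 0 := hF.liminf_eq
  filter_upwards [(lintegral_eq_zero_iff (by fun_prop)).1 hzero] with ω hω
  have hle : 2 / Real.pi ^ 2 * U ω ^ 2 ≤ 0 := ENNReal.ofReal_eq_zero.1 hω
  have hpi : 0 < 2 / Real.pi ^ 2 := by positivity
  exact pow_eq_zero_iff two_ne_zero |>.1 (le_antisymm (by nlinarith) (sq_nonneg _))

variable {Ω ι : Type*} [MeasurableSpace Ω] {P : Measure Ω} {ν : Measure ℝ} {X : ι → Ω → ℝ}
  {A : ℕ → Finset ι}

theorem charFun_map_mul_sum_eq_pow (hX : ∀ i, Measurable (X i)) (hind : iIndepFun X P)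
    (hlaw : ∀ i, P.map (X i) = ν) (B : Finset ι) (r t : ℝ) :
    charFun (P.map fun ω => r * ∑ i ∈ B, X i ω) t = charFun ν (r * t) ^ B.card := by
  rw [charFun_map_mul_comp (Finset.aemeasurable_fun_sum _ fun i _ => (hX i).aemeasurable),
    (hind.restrict _).charFun_map_fun_finsetSum_eq_prod fun i _ => (hX i).aemeasurable]
  simp only [hlaw, Finset.prod_const, Finset.prod_apply]

theorem integral_id_eq_zero_of_tendsto_integral_abs_sum (hX : ∀ i, Measurable (X i))
    (hlaw : ∀ i, P.map (X i) = ν) (hint : Integrable id ν)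
    (hcard : Tendsto (fun n => (A n).card) atTop atTop)
    (h : Tendsto (fun n => (∫ ω, |∑ i ∈ A n, X i ω| ∂P) / √((A n).card : ℝ)) atTop (𝓝 0)) :
    ∫ x, x ∂ν = 0 := by
  have hXint (i : ι) : Integrable (X i) P :=
    Integrable.comp_measurable (f := X i) (g := id) (by rwa [hlaw i]) (hX i)
  have hmean (i : ι) : ∫ ω, X i ω ∂P = ∫ x, x ∂ν := by
    rw [← hlaw i, integral_map (hX i).aemeasurable (by fun_prop)]
  rw [← abs_nonpos_iff]
  refine ge_of_tendsto h ?_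
  filter_upwards [hcard.eventually_ge_atTop 1] with n hn
  have hone : (1 : ℝ) ≤ (A n).card := by exact_mod_cast hn
  rw [le_div_iff₀ (by positivity)]
  calc |∫ x, x ∂ν| * √((A n).card : ℝ)
      ≤ |∫ x, x ∂ν| * (A n).card := by
        gcongr
        exact Real.sqrt_le_self_iff.2 (.inr hone)
    _ = |∫ ω, ∑ i ∈ A n, X i ω ∂P| := by
        rw [integral_finsetSum _ fun i _ => hXint i, Finset.sum_congr rfl fun i _ => hmean i,
          Finset.sum_const, nsmul_eq_mul, abs_mul, Nat.abs_cast, mul_comm]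
    _ ≤ ∫ ω, |∑ i ∈ A n, X i ω| ∂P := abs_integral_le_integral_abs

variable [IsProbabilityMeasure P] [IsProbabilityMeasure ν]

/-- The characteristic function of `∑_{i ∈ A} X_i / √|A|` at `1` tends to `1`, so that
`1 - |charFun ν t|² = o(t²)` along `t = |A|^{-1/2}`. The left side is the mean of
`1 - cos (t (x - y))` for independent `x`, `y` of law `ν`, and Fatou's lemma gives `x = y`. -/
theorem ae_prod_eq_of_tendsto_integral_abs_sum (hX : ∀ i, Measurable (X i))
    (hind : iIndepFun X P) (hlaw : ∀ i, P.map (X i) = ν) (hint : Integrable id ν)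
    (hcard : Tendsto (fun n => (A n).card) atTop atTop)
    (h : Tendsto (fun n => (∫ ω, |∑ i ∈ A n, X i ω| ∂P) / √((A n).card : ℝ)) atTop (𝓝 0)) :
    ∀ᵐ z ∂(ν.prod ν), z.1 = z.2 := by
  have hXint (i : ι) : Integrable (X i) P :=
    Integrable.comp_measurable (f := X i) (g := id) (by rwa [hlaw i]) (hX i)
  set t : ℕ → ℝ := fun n => (√((A n).card : ℝ))⁻¹
  have hsqrt : Tendsto (fun n => √((A n).card : ℝ)) atTop atTop :=
    Real.tendsto_sqrt_atTop.comp (tendsto_natCast_atTop_atTop.comp hcard)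
  have ht : Tendsto t atTop (𝓝 0) := tendsto_inv_atTop_zero.comp hsqrt
  have hchar : Tendsto (fun n => charFun ν (t n) ^ (A n).card) atTop (𝓝 1) := by
    rw [tendsto_iff_norm_sub_tendsto_zero]
    refine squeeze_zero (fun _ => norm_nonneg _) (fun n => ?_) h
    have hY := (integrable_finsetSum (A n) fun i _ => hXint i).const_mul (t n)
    calc ‖charFun ν (t n) ^ (A n).card - 1‖
        = ‖charFun (P.map fun ω => t n * ∑ i ∈ A n, X i ω) 1 - 1‖ := by
          rw [charFun_map_mul_sum_eq_pow hX hind hlaw, mul_one]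
      _ ≤ |1| * ∫ ω, |t n * ∑ i ∈ A n, X i ω| ∂P := norm_charFun_map_sub_one_le hY 1
      _ = (∫ ω, |∑ i ∈ A n, X i ω| ∂P) / √((A n).card : ℝ) := by
          have ht_nonneg : 0 ≤ t n := by positivity
          simp only [abs_one, one_mul, abs_mul, abs_of_nonneg ht_nonneg, integral_const_mul]
          exact inv_mul_eq_div _ _
  have hpow : Tendsto (fun n => (‖charFun ν (t n)‖ ^ 2) ^ (A n).card) atTop (𝓝 1) := by
    simpa [← pow_mul, mul_comm] using (hchar.norm.pow 2)
  have hgap := tendsto_mul_one_sub_of_tendsto_pow (fun n => sq_nonneg _)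
    (fun n => pow_le_one₀ (norm_nonneg _) (norm_charFun_le_one _)) hpow
  have hcos (s : ℝ) : Integrable (fun z : ℝ × ℝ => Real.cos (s * (z.1 - z.2))) (ν.prod ν) :=
    Integrable.of_bound (by fun_prop) 1 (ae_of_all _ fun z => Real.abs_cos_le_one _)
  have hdiff := ae_eq_zero_of_tendsto_integral_one_sub_cos (P := ν.prod ν)
    (U := fun z => z.1 - z.2) (by fun_prop)
    ((hsqrt.eventually_ne_atTop 0).mono fun n hn => inv_ne_zero hn) ht <| hgap.congr fun n => by
      rw [integral_sub (integrable_const _) (hcos _), ← norm_charFun_sq_eq_integral_cos,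
        integral_const, probReal_univ, one_smul, inv_pow, Real.sq_sqrt (Nat.cast_nonneg _),
        div_inv_eq_mul, mul_comm]
  filter_upwards [hdiff] with z hz using sub_eq_zero.1 hz

theorem eq_dirac_zero_of_tendsto_integral_abs_sum (hX : ∀ i, Measurable (X i))
    (hind : iIndepFun X P) (hlaw : ∀ i, P.map (X i) = ν) (hint : Integrable id ν)
    (hcard : Tendsto (fun n => (A n).card) atTop atTop)
    (h : Tendsto (fun n => (∫ ω, |∑ i ∈ A n, X i ω| ∂P) / √((A n).card : ℝ)) atTop (𝓝 0)) :
    ν = Measure.dirac 0 := by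
  obtain ⟨c, hc⟩ := (Measure.ae_ae_of_ae_prod
    (ae_prod_eq_of_tendsto_integral_abs_sum hX hind hlaw hint hcard h)).exists
  have hconst : id =ᵐ[ν] fun _ => c := hc.mono fun y hy => hy.symm
  have hc0 : c = 0 := by
    calc c = ∫ _, c ∂ν := by simp
      _ = ∫ x, x ∂ν := (integral_congr_ae hconst).symm
      _ = 0 := integral_id_eq_zero_of_tendsto_integral_abs_sum hX hlaw hint hcard h
  rw [← Measure.map_id (μ := ν), Measure.map_congr hconst, Measure.map_const, measure_univ,
    one_smul, hc0]

end SumIID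

theorem eq_dirac_zero_of_ae_eq_sum_coboundary {ν : Measure ℝ} [IsProbabilityMeasure ν]
    (hd₀ : d ≠ 0) (hd : d ≤ 2) {ι : Type*} [Fintype ι] (x : ι → Site d) {Z : ι → Field d → ℝ}
    (hZ : ∀ s, Integrable (Z s) (disorderMeasure d ν))
    (h : ∀ᵐ η ∂(disorderMeasure d ν), η 0 = ∑ s, (Z s η - Z s (shift (-x s) η))) :
    ν = Measure.dirac 0 := by
  set P := disorderMeasure d ν
  have hlaw (i : Site d) : P.map (fun η => η i) = ν :=
    Measure.infinitePi_map_eval (fun _ : Site d => ν) i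
  have hint : Integrable id ν := by
    have heval : Measurable fun η : Field d => η 0 := measurable_pi_apply 0
    rw [← hlaw 0, integrable_map_measure (by fun_prop) heval.aemeasurable]
    refine (integrable_finsetSum Finset.univ fun s _ =>
      (hZ s).sub (integrable_comp_shift (hZ s) (-x s))).congr ?_
    filter_upwards [h] with η hη using hη.symm
  have hall : ∀ᵐ η ∂P, ∀ i : Site d,
      η i = ∑ s, (Z s (shift (-i) η) - Z s (shift (-(i + x s)) η)) := by
    refine ae_all_iff.2 fun i => ?_
    have hi := (IsStationary.measurePreserving_shift (P := P) (-i)).quasiMeasurePreserving.ae h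
    filter_upwards [hi] with η hη
    simpa [shift_shift, ← neg_add_rev, shift] using hη
  have hsum := tendsto_finsetSum (Finset.univ : Finset ι) fun s _ =>
    tendsto_integral_abs_sum_coboundary_box hd₀ hd (hZ s) (x s)
  rw [Finset.sum_const_zero] at hsum
  refine eq_dirac_zero_of_tendsto_integral_abs_sum (A := box d) (fun i => measurable_pi_apply i)
    (iIndepFun_disorderMeasure ν) hlaw hint ?_
    (squeeze_zero (fun L => by positivity) (fun L => ?_) hsum)
  · simpa only [card_box] using tendsto_pow_atTop hd₀
  rw [← Finset.sum_div]
  gcongr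
  have hi (s : ι) : Integrable (fun η => |∑ i ∈ box d L,
      (Z s (shift (-i) η) - Z s (shift (-(i + x s)) η))|) P :=
    (integrable_finsetSum _ fun i _ =>
      (integrable_comp_shift (hZ s) _).sub (integrable_comp_shift (hZ s) _)).abs
  rw [← integral_finsetSum _ fun s _ => hi s]
  refine integral_mono_of_nonneg (ae_of_all _ fun η => abs_nonneg _)
    (integrable_finsetSum _ fun s _ => hi s) ?_
  filter_upwards [hall] with η hη
  rw [Finset.sum_congr rfl fun i _ => hη i, Finset.sum_comm]
  exact Finset.abs_sum_le_sum_abs _ _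

/-! ### Force balance -/

section GibbsDensity

/-- The probability density proportional to `exp (-h)`. It is zero when `exp (-h)` has infinite
integral, since then the normalising factor is `∞⁻¹ = 0`. -/
def gibbsDensity (h : ℝ → ℝ) (t : ℝ) : ℝ≥0∞ :=
  (∫⁻ s, ENNReal.ofReal (Real.exp (-h s)))⁻¹ * ENNReal.ofReal (Real.exp (-h t))

theorem integral_gibbsDensity_mul_deriv_eq_zero {h h' : ℝ → ℝ} (hh : ∀ t, HasDerivAt h (h' t) t)
    (hint : Integrable fun t => (gibbsDensity h t).toReal)
    (hint' : Integrable fun t => (gibbsDensity h t).toReal * h' t) :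
    ∫ t, (gibbsDensity h t).toReal * h' t = 0 := by
  have hderiv (t : ℝ) : HasDerivAt (fun t => (gibbsDensity h t).toReal)
      (-((gibbsDensity h t).toReal * h' t)) t := by
    simp only [gibbsDensity, ENNReal.toReal_mul, ENNReal.toReal_ofReal (Real.exp_nonneg _)]
    refine ((hh t).fun_neg.exp.const_mul _).congr_deriv ?_
    ring
  rw [← neg_eq_zero, ← integral_neg]
  exact integral_eq_zero_of_hasDerivAt_of_integrable hderiv hint'.neg hint

variable {X : Type*} [MeasurableSpace X] {m : Measure X} {H : X → ℝ → ℝ} {T : X → ℝ → X}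

theorem measurable_gibbsDensity (hH : Measurable fun q : X × ℝ => H q.1 q.2) :
    Measurable fun q : X × ℝ => gibbsDensity (H q.1) q.2 := by
  have hW : Measurable fun q : X × ℝ => ENNReal.ofReal (Real.exp (-H q.1 q.2)) := by fun_prop
  exact (hW.lintegral_prod_right'.inv.comp measurable_fst).mul hW

theorem map_withDensity_gibbsDensity [SFinite m] (hH : Measurable fun q : X × ℝ => H q.1 q.2)
    (hT : Measurable fun q : X × ℝ => T q.1 q.2)
    (hinv : ∀ g : X → ℝ≥0∞, Measurable g →
      ∫⁻ u, (∫⁻ t, gibbsDensity (H u) t * g (T u t)) ∂m = ∫⁻ u, g u ∂m) :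
    ((m.prod volume).withDensity fun q => gibbsDensity (H q.1) q.2).map (fun q => T q.1 q.2) =
      m := by
  refine Measure.ext_of_lintegral _ fun g hg => ?_
  have hD := measurable_gibbsDensity hH
  have hgT : Measurable fun q : X × ℝ => g (T q.1 q.2) := hg.comp hT
  rw [lintegral_map hg hT, lintegral_withDensity_eq_lintegral_mul _ hD hgT,
    lintegral_prod _ (hD.mul hgT).aemeasurable]
  exact hinv g hg

/-- Integration by parts in each fibre `{u} × ℝ`. The hypothesis `hinv` says that `m` is invariant
under resampling `u` as `T u t`, with `t` drawn from the density proportional to `exp (-H u)`. -/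
theorem integral_eq_zero_of_gibbsDensity_invariant [IsFiniteMeasure m]
    (hH : Measurable fun q : X × ℝ => H q.1 q.2) (hT : Measurable fun q : X × ℝ => T q.1 q.2)
    (hinv : ∀ g : X → ℝ≥0∞, Measurable g →
      ∫⁻ u, (∫⁻ t, gibbsDensity (H u) t * g (T u t)) ∂m = ∫⁻ u, g u ∂m)
    {G : X → ℝ} (hG : Integrable G m) (hderiv : ∀ u t, HasDerivAt (H u) (G (T u t)) t) :
    ∫ u, G u ∂m = 0 := by
  set D : X × ℝ → ℝ≥0∞ := fun q => gibbsDensity (H q.1) q.2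
  set M := (m.prod volume).withDensity D
  have hD : Measurable D := measurable_gibbsDensity hH
  have hmap : M.map (fun q => T q.1 q.2) = m := map_withDensity_gibbsDensity hH hT hinv
  have hM : M Set.univ = m Set.univ := by
    rw [← hmap, Measure.map_apply hT MeasurableSet.univ, Set.preimage_univ]
  have : IsFiniteMeasure M := ⟨hM ▸ measure_lt_top m _⟩
  have hDtop : ∀ᵐ q ∂(m.prod volume), D q < ∞ := by
    refine ae_lt_top hD ?_
    rw [← setLIntegral_univ, ← withDensity_apply _ MeasurableSet.univ]
    exact measure_ne_top M _
  have hone := (integrable_withDensity_iff_integrable_smul' hD hDtop).1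
    (integrable_const (1 : ℝ) : Integrable (fun _ => (1 : ℝ)) M)
  have hGT : Integrable (fun q => (D q).toReal • G (T q.1 q.2)) (m.prod volume) := by
    refine (integrable_withDensity_iff_integrable_smul' hD hDtop).1 ?_
    exact Integrable.comp_measurable (f := fun q : X × ℝ => T q.1 q.2) (by rwa [hmap]) hT
  calc ∫ u, G u ∂m
      = ∫ q, G (T q.1 q.2) ∂M := by
        rw [← integral_map hT.aemeasurable (by rw [hmap]; exact hG.aestronglyMeasurable), hmap]
    _ = ∫ u, (∫ t, (D (u, t)).toReal • G (T u t)) ∂m := by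
        rw [integral_withDensity_eq_integral_toReal_smul hD hDtop, integral_prod _ hGT]
    _ = 0 := by
        refine integral_eq_zero_of_ae ?_
        filter_upwards [hGT.prod_right_ae, hone.prod_right_ae] with u hu hu_one
        simp only [smul_eq_mul, mul_one, D, Pi.zero_apply] at hu hu_one ⊢
        exact integral_gibbsDensity_mul_deriv_eq_zero (hderiv u) hu_one hu

end GibbsDensity

variable {p : Site d → ℝ}

/-- The steps `x` of the random walk with kernel `p`. -/
abbrev Step (p : Site d → ℝ) : Type := {x : Site d // 0 < p x}

/-- The edge from `i` to `i - x`, so that the walk kernel at its increment is `p x`. -/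
def outEdge (i : Site d) (x : Step p) : Edge p := ⟨(i, i - x), by simpa using x.2⟩

/-- The gradient field obtained by raising the height at the site `i` by `t`. -/
def raise (i : Site d) (ψ : GradField p) (t : ℝ) : GradField p :=
  grad p (heights ψ + Pi.single i t)

theorem raise_apply (i : Site d) (ψ : GradField p) (t : ℝ) (e : Edge p) :
    (raise i ψ t).1 e =
      ψ.1 e + ((Pi.single i t : Field d) e.1.1 - (Pi.single i t : Field d) e.1.2) := by
  have h : ψ.1 e = heights ψ e.1.1 - heights ψ e.1.2 := ψ.2.choose_spec e
  simp only [raise, grad, Pi.add_apply, h]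
  ring

theorem raise_apply_outEdge (i : Site d) (ψ : GradField p) (t : ℝ) (x : Step p) :
    (raise i ψ t).1 (outEdge i x) = if x.1 = 0 then 0 else ψ.1 (outEdge i x) + t := by
  split_ifs with hx
  · simp [raise, grad, outEdge, hx]
  · simp [raise_apply, outEdge, hx]

theorem measurable_gradField_apply (e : Edge p) : Measurable fun ψ : GradField p => ψ.1 e :=
  (measurable_pi_apply e).comp measurable_subtype_coe

theorem measurable_raise (i : Site d) :
    Measurable fun q : GradField p × ℝ => raise i q.1 q.2 := by
  refine Measurable.subtype_mk (measurable_pi_lambda _ fun e => ?_)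
  have hsingle (j : Site d) : Measurable fun t : ℝ => (Pi.single i t : Field d) j :=
    (measurable_pi_apply j).comp (continuous_single (A := fun _ => ℝ) i).measurable
  change Measurable fun q : GradField p × ℝ => (raise i q.1 q.2).1 e
  simp only [raise_apply]
  exact ((measurable_gradField_apply e).comp measurable_fst).add
    (((hsingle _).sub (hsingle _)).comp measurable_snd)

theorem lintegral_finiteGradGibbs_eq (hp : ∀ x, 0 ≤ p x) (V : ℝ → ℝ) (η : Field d)
    (Λ : Finset (Site d)) {ψ : GradField p} {b : Field d} (hb : grad p b = ψ)
    (hw : Measurable (weight p V η Λ b)) {f : GradField p → ℝ≥0∞} (hf : Measurable f) :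
    ∫⁻ ψ', f ψ' ∂(finiteGradGibbs p V η Λ ψ) =
      (partitionFn p V η Λ b)⁻¹ * ∫⁻ y, weight p V η Λ b y * f (grad p (glue Λ b y)) := by
  have hgrad : Measurable fun φ => f (grad p φ) := hf.comp (measurable_grad p)
  have hglue : Measurable fun y => f (grad p (glue Λ b y)) := hgrad.comp (measurable_glue Λ b)
  rw [finiteGradGibbs, map_grad_finiteGibbs_eq hp V η Λ _ b ((grad_heights ψ).trans hb.symm),
    lintegral_map hf (measurable_grad p), finiteGibbs, lintegral_smul_measure,
    lintegral_map hgrad (measurable_glue Λ b),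
    lintegral_withDensity_eq_lintegral_mul _ hw hglue]
  rfl

/-- The height field with gradient `ψ` that vanishes at `i`. -/
def heightsFrom (i : Site d) (ψ : GradField p) : Field d := fun j => heights ψ j - heights ψ i

theorem grad_heightsFrom (i : Site d) (ψ : GradField p) : grad p (heightsFrom i ψ) = ψ :=
  (Subtype.ext (funext fun _ => sub_sub_sub_cancel_right _ _ _)).trans (grad_heights ψ)

theorem glue_singleton_heightsFrom (i : Site d) (ψ : GradField p)
    (y : ({i} : Finset (Site d)) → ℝ) :
    glue {i} (heightsFrom i ψ) y = heightsFrom i ψ + Pi.single i (y default) := by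
  funext j
  by_cases hj : j = i
  · subst hj
    simp [glue, heightsFrom, Subsingleton.elim _ (default : ({j} : Finset (Site d)))]
  · simp [glue, hj]

theorem grad_glue_singleton_heightsFrom (i : Site d) (ψ : GradField p)
    (y : ({i} : Finset (Site d)) → ℝ) :
    grad p (glue {i} (heightsFrom i ψ) y) = raise i ψ (y default) := by
  refine Subtype.ext (funext fun e => ?_)
  simp only [glue_singleton_heightsFrom, raise, grad, Pi.add_apply, heightsFrom]
  ring

section SingleSite

variable [Fintype (Step p)] {V : ℝ → ℝ}

theorem finsum_edge_eq_sum_step (hp : ∀ x, 0 ≤ p x) (V : ℝ → ℝ) (i : Site d) (φ : Field d) :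
    ∑ᶠ j, p (i - j) * V (φ i - φ j) = ∑ x : Step p, p x * V ((grad p φ).1 (outEdge i x)) := by
  rw [← finsum_comp_equiv (Equiv.subLeft i)]
  simp only [Equiv.subLeft_apply, sub_sub_cancel]
  rw [finsum_eq_sum_of_support_subset
    (s := Finset.univ.map (Function.Embedding.subtype fun x => 0 < p x)), Finset.sum_map]
  · rfl
  · intro x hx
    simpa using (hp x).lt_of_ne' (left_ne_zero_of_mul hx)

theorem energy_singleton (hp : ∀ x, 0 ≤ p x) (V : ℝ → ℝ) (η : Field d) (i : Site d)
    (φ : Field d) :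
    energy p V η {i} φ = ∑ x : Step p, p x * V ((grad p φ).1 (outEdge i x)) -
      1 / 2 * (p 0 * V 0) - η i * φ i := by
  have hsupp : (Function.support fun j => p (i - j) * V (φ i - φ j)).Finite := by
    have hpos : {x | 0 < p x}.Finite := Set.finite_coe_iff.1 (Finite.of_fintype (Step p))
    refine (hpos.preimage (sub_right_injective (b := i)).injOn).subset ?_
    exact fun j hj => (hp _).lt_of_ne' (left_ne_zero_of_mul hj)
  have hsplit := add_finsum_cond_ne i hsupp
  rw [finsum_edge_eq_sum_step hp] at hsplit
  simp only [sub_self] at hsplit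
  simp only [energy, Finset.sum_singleton, Finset.mem_singleton, sub_self]
  linarith

/-- The energy at the site `i`, under the external field `a`, after the height at `i` in the
gradient field `ψ` has been raised by `t`. The self-loop of the walk enters with weight `1 / 2`,
as in `energy`. -/
def siteEnergy (V : ℝ → ℝ) (a : ℝ) (i : Site d) (ψ : GradField p) (t : ℝ) : ℝ :=
  ∑ x : Step p, p x * V ((raise i ψ t).1 (outEdge i x)) - 1 / 2 * (p 0 * V 0) - a * t

theorem measurable_siteEnergy (hV : Measurable V) (a : ℝ) (i : Site d) :
    Measurable fun q : GradField p × ℝ => siteEnergy V a i q.1 q.2 := by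
  have hterm (x : Step p) : Measurable fun q : GradField p × ℝ =>
      p x * V ((raise i q.1 q.2).1 (outEdge i x)) :=
    (hV.comp ((measurable_gradField_apply _).comp (measurable_raise i))).const_mul _
  exact ((Finset.measurable_fun_sum _ fun x _ => hterm x).sub_const _).sub
    (measurable_snd.const_mul a)

theorem hasDerivAt_siteEnergy (hV : Differentiable ℝ V) (hV₀ : deriv V 0 = 0) (a : ℝ)
    (i : Site d) (ψ : GradField p) (t : ℝ) :
    HasDerivAt (siteEnergy V a i ψ)
      (∑ x : Step p, p x * deriv V ((raise i ψ t).1 (outEdge i x)) - a) t := by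
  have hterm (x : Step p) : HasDerivAt (fun t => V ((raise i ψ t).1 (outEdge i x)))
      (deriv V ((raise i ψ t).1 (outEdge i x))) t := by
    simp only [raise_apply_outEdge]
    split_ifs
    · simpa only [hV₀] using hasDerivAt_const t (V 0)
    · exact (hV _).hasDerivAt.comp_const_add _ t
  have hsum := HasDerivAt.fun_sum fun x (_ : x ∈ Finset.univ) => (hterm x).const_mul (p x)
  simpa only [mul_one, id] using!
    (hsum.sub_const (1 / 2 * (p 0 * V 0))).sub ((hasDerivAt_id t).const_mul a)

theorem weight_singleton_heightsFrom (hp : ∀ x, 0 ≤ p x) (V : ℝ → ℝ) (η : Field d) (i : Site d)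
    (ψ : GradField p) (y : ({i} : Finset (Site d)) → ℝ) :
    weight p V η {i} (heightsFrom i ψ) y =
      ENNReal.ofReal (Real.exp (-siteEnergy V (η i) i ψ (y default))) := by
  have hi : glue {i} (heightsFrom i ψ) y i = y default := by
    simp [glue_singleton_heightsFrom, heightsFrom]
  rw [weight, energy_singleton hp, grad_glue_singleton_heightsFrom, hi, siteEnergy]

theorem lintegral_finiteGradGibbs_singleton (hp : ∀ x, 0 ≤ p x) (hV : Measurable V)
    (η : Field d) (i : Site d) (ψ : GradField p) {f : GradField p → ℝ≥0∞} (hf : Measurable f) :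
    ∫⁻ ψ', f ψ' ∂(finiteGradGibbs p V η {i} ψ) =
      ∫⁻ t, gibbsDensity (siteEnergy V (η i) i ψ) t * f (raise i ψ t) := by
  set W : ℝ → ℝ≥0∞ := fun t => ENNReal.ofReal (Real.exp (-siteEnergy V (η i) i ψ t))
  have hW : Measurable W :=
    ((measurable_siteEnergy hV (η i) i).comp measurable_prodMk_left).neg.exp.ennreal_ofReal
  have hraise : Measurable fun t => f (raise i ψ t) :=
    hf.comp ((measurable_raise i).comp measurable_prodMk_left)
  have hvol (F : ℝ → ℝ≥0∞) :
      ∫⁻ y : ({i} : Finset (Site d)) → ℝ, F (y default) = ∫⁻ t, F t :=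
    (volume_preserving_funUnique ({i} : Finset (Site d)) ℝ).lintegral_comp_emb
      (MeasurableEquiv.measurableEmbedding _) F
  have hweight : weight p V η {i} (heightsFrom i ψ) = fun y => W (y default) :=
    funext (weight_singleton_heightsFrom hp V η i ψ)
  have hweight_meas : Measurable (weight p V η {i} (heightsFrom i ψ)) :=
    hweight ▸ hW.comp (measurable_pi_apply _)
  rw [lintegral_finiteGradGibbs_eq hp V η {i} (grad_heightsFrom i ψ) hweight_meas hf, partitionFn]
  simp only [hweight, grad_glue_singleton_heightsFrom, gibbsDensity, mul_assoc]
  rw [hvol W, hvol fun t => W t * f (raise i ψ t)]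
  exact (lintegral_const_mul _ (hW.mul hraise)).symm

theorem deriv_neg_of_even (hV : Function.Even V) (t : ℝ) : deriv V (-t) = -deriv V t := by
  rw [← neg_eq_iff_eq_neg, ← deriv_comp_neg]
  exact congrArg (deriv · t) (funext hV)

theorem deriv_zero_of_even (hV : Function.Even V) : deriv V 0 = 0 := by
  have h := deriv_neg_of_even hV 0
  rwa [neg_zero, self_eq_neg] at h

/-- The Schwinger–Dyson equation. -/
theorem IsGradientGibbs.sum_force (hp : ∀ x, 0 ≤ p x) (hV : Differentiable ℝ V)
    (hV₀ : deriv V 0 = 0) {η : Field d} {μ : Measure (GradField p)}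
    (hμ : IsGradientGibbs p V η μ) (i : Site d)
    (hint : ∀ x : Step p, Integrable (fun ψ : GradField p => deriv V (ψ.1 (outEdge i x))) μ) :
    ∑ x : Step p, p x * ∫ ψ, deriv V (ψ.1 (outEdge i x)) ∂μ = η i := by
  have := hμ.isProbabilityMeasure
  have hVm : Measurable V := hV.continuous.measurable
  have hterm (x : Step p) :
      Integrable (fun ψ : GradField p => p x * deriv V (ψ.1 (outEdge i x))) μ :=
    (hint x).const_mul _
  have hsum := integrable_finsetSum Finset.univ fun x _ => hterm x
  have hzero := integral_eq_zero_of_gibbsDensity_invariant (T := raise i)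
    (measurable_siteEnergy hVm (η i) i) (measurable_raise i)
    (fun f hf => by
      simp only [← lintegral_finiteGradGibbs_singleton hp hVm η i _ hf]
      exact hμ.dlr {i} f hf)
    (G := fun ψ => ∑ x : Step p, p x * deriv V (ψ.1 (outEdge i x)) - η i)
    (hsum.sub (integrable_const _)) (hasDerivAt_siteEnergy hV hV₀ (η i) i)
  rw [integral_sub hsum (integrable_const _), integral_const, probReal_univ, one_smul,
    integral_finsetSum _ fun x _ => hterm x, sub_eq_zero] at hzero
  simpa only [integral_const_mul] using hzero

end SingleSite

/-! ### Covariance of the forces -/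

theorem measurable_gradShift (r : Site d) : Measurable (gradShift (p := p) r) :=
  Measurable.subtype_mk (measurable_pi_lambda _ fun e => measurable_gradField_apply (edgeShift r e))

/-- The expected force `∫ V'(φ'_{ij}) dμ[η]` along the edge `e = (i, j)`. -/
def force (V : ℝ → ℝ) (μ : Kernel (Field d) (GradField p)) (e : Edge p) (η : Field d) : ℝ :=
  ∫ ψ, deriv V (ψ.1 e) ∂(μ η)

section Covariance

variable {V : ℝ → ℝ} {P : Measure (Field d)} {μ : Kernel (Field d) (GradField p)}

theorem IsCovariantGradientGibbs.force_shift (hμ : IsCovariantGradientGibbs p V P μ)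
    (r : Site d) (e : Edge p) :
    ∀ᵐ η ∂P, force V μ e (shift r η) = force V μ (edgeShift r e) η := by
  filter_upwards [hμ.covariant r] with η hη
  have hmap : μ (shift r η) = (μ η).map (gradShift r) := by
    refine Measure.ext_of_lintegral _ fun f hf => ?_
    rw [lintegral_map hf (measurable_gradShift r)]
    exact hη f hf
  have hforce : Measurable fun ψ : GradField p => deriv V (ψ.1 e) :=
    (measurable_deriv V).comp (measurable_gradField_apply e)
  rw [force, hmap, integral_map (measurable_gradShift r).aemeasurable hforce.aestronglyMeasurable]
  rfl

/-- The reversed edge. -/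
def edgeSwap (hp : Function.Even p) (e : Edge p) : Edge p :=
  ⟨(e.1.2, e.1.1), by rw [← neg_sub, hp]; exact e.2⟩

theorem force_edgeSwap (hp : Function.Even p) (hV : Function.Even V)
    (μ : Kernel (Field d) (GradField p)) (e : Edge p) (η : Field d) :
    force V μ (edgeSwap hp e) η = -force V μ e η := by
  have hswap (ψ : GradField p) : ψ.1 (edgeSwap hp e) = -ψ.1 e := by
    obtain ⟨φ, hφ⟩ := ψ.2
    rw [hφ, hφ, neg_sub]
    rfl
  simp only [force, hswap, deriv_neg_of_even hV, integral_neg]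

/-- The involution `x ↦ -x` of the steps of a symmetric walk. -/
def negStep (hp : Function.Even p) : Step p ≃ Step p :=
  (Equiv.neg (Site d)).subtypeEquiv fun x => by simp [hp x]

theorem IsCovariantGradientGibbs.force_negStep (hp : Function.Even p) (hV : Function.Even V)
    (hμ : IsCovariantGradientGibbs p V P μ) (x : Step p) :
    ∀ᵐ η ∂P, force V μ (outEdge 0 (negStep hp x)) η = -force V μ (outEdge 0 x) (shift (-x) η) := by
  have hedge : outEdge 0 (negStep hp x) = edgeSwap hp (edgeShift (-x.1) (outEdge 0 x)) :=
    Subtype.ext (Prod.ext (by simp [edgeSwap, edgeShift, outEdge])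
      (by simp [edgeSwap, edgeShift, outEdge, negStep]))
  filter_upwards [hμ.force_shift (-x.1) (outEdge 0 x)] with η hη
  rw [hη, hedge, force_edgeSwap hp hV]

theorem IsCovariantGradientGibbs.ae_eq_sum_coboundary [Fintype (Step p)] (hp₀ : ∀ x, 0 ≤ p x)
    (hp : Function.Even p) (hVd : Differentiable ℝ V) (hV : Function.Even V)
    (hμ : IsCovariantGradientGibbs p V P μ) (hint : HasIntegrableForce p V P μ) :
    ∀ᵐ η ∂P, η 0 = ∑ x : Step p, (p x / 2 * force V μ (outEdge 0 x) η -
      p x / 2 * force V μ (outEdge 0 x) (shift (-x) η)) := by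
  filter_upwards [hμ.gibbs, ae_all_iff.2 fun x => (hint (outEdge 0 x)).1,
    ae_all_iff.2 fun x => hμ.force_negStep hp hV x] with η hgibbs hη hneg
  have hbalance : ∑ x : Step p, p x * force V μ (outEdge 0 x) η = η 0 :=
    hgibbs.sum_force hp₀ hVd (deriv_zero_of_even hV) 0 hη
  have hreflected : ∑ x : Step p, p x * force V μ (outEdge 0 x) (shift (-x) η) = -η 0 := by
    rw [← hbalance, ← (negStep hp).sum_comp fun x => p x * force V μ (outEdge 0 x) η,
      ← Finset.sum_neg_distrib]
    refine Finset.sum_congr rfl fun x _ => ?_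
    have hpx : p (negStep hp x) = p x := hp x
    rw [hneg x, hpx]
    ring
  simp only [div_mul_eq_mul_div, ← sub_div, ← Finset.sum_div, Finset.sum_sub_distrib, hbalance,
    hreflected]
  ring

end Covariance

end GradGibbs

end

theorem theorem1p1_general {d : ℕ} (hd₀ : d ≠ 0) (hd : d ≤ 2) (V : ℝ → ℝ)
    (hVd : Differentiable ℝ V) (hV : Function.Even V) (p : GradGibbs.Site d → ℝ)
    (hp₀ : ∀ x, 0 ≤ p x) (hp : Function.Even p) (hp_finite : p.support.Finite)
    (ν : Measure ℝ) [IsProbabilityMeasure ν] (hν : ν ≠ Measure.dirac 0) :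
    ¬ ∃ μ : Kernel (GradGibbs.Field d) (GradGibbs.GradField p),
      GradGibbs.IsCovariantGradientGibbs p V (GradGibbs.disorderMeasure d ν) μ ∧
      GradGibbs.HasIntegrableForce p V (GradGibbs.disorderMeasure d ν) μ := by
  rintro ⟨μ, hμ, hint⟩
  have : Finite (GradGibbs.Step p) := hp_finite.subset fun x hx => ne_of_gt hx
  have := Fintype.ofFinite (GradGibbs.Step p)
  exact hν <| GradGibbs.eq_dirac_zero_of_ae_eq_sum_coboundary hd₀ hd
    (fun x : GradGibbs.Step p => x.1)
    (fun x => (hint (GradGibbs.outEdge 0 x)).2.const_mul (p x / 2))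
    (hμ.ae_eq_sum_coboundary hp₀ hp hVd hV hint)

theorem theorem1p1 (V : ℝ → ℝ) (hV : GradGibbs.IsPotential V)
    (p : GradGibbs.Site 2 → ℝ) (hp : GradGibbs.IsWalkKernel p)
    (ν : Measure ℝ) (hν : GradGibbs.IsDisorderLaw ν) :
    ¬ ∃ μ : Kernel (GradGibbs.Field 2) (GradGibbs.GradField p),
      GradGibbs.IsCovariantGradientGibbs p V (GradGibbs.disorderMeasure 2 ν) μ ∧
      GradGibbs.HasIntegrableForce p V (GradGibbs.disorderMeasure 2 ν) μ := by
  have := hν.isProbabilityMeasure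
  exact theorem1p1_general two_ne_zero le_rfl V (hV.contDiff.differentiable one_ne_zero) hV.even p
    hp.nonneg hp.symm hp.finite_range ν (by rintro rfl; simpa using hν.second_moment_ne_zero)
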